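/- Let $\Gamma$ be a finite directed multigraph (loops and parallel edges allowed) whose edges carry weights $\mathrm{wt}(e)$ in a commutative ring $R$ (for example indeterminates, with $R=\mathbb Z[E]$ the polynomial ring in the edge weights), with $n$ vertices. Let $\tilde\Gamma$ be a $k$-fold cover of $\Gamma$: a finite directed multigraph with a projection $\pi\colon\tilde\Gamma\to\Gamma$ that is a morphism of directed graphs, such that every vertex and every edge of $\Gamma$ has exactly $k$ lifts, the edges leaving (respectively entering) a vertex $w$ of $\tilde\Gamma$ are mapped bijectively onto the edges leaving (respectively entering) $\pi(w)$, and every lifted edge has the weight of its base edge. An arborescence rooted at $v$ is a set $T$ of edges such that from every vertex there is exactly one directed walk to $v$ with edges in $T$ (that is, a spanning tree directed towards $v$); let $A_v(\Gamma)=\sum_T\prod_{e\in T}\mathrm{wt}(e)$, the sum being over all arborescences $T$ of $\Gamma$ rooted at $v$, and similarly for $\tilde\Gamma$. Label the lifts of each vertex $v_i$ of $\Gamma$ in an arbitrary way by $v_i^1,\dots,v_i^k$. Let $[\mathscr L(\Gamma)]_{\mathbb Z[E]}=D-A$ be the $(k-1)n\times(k-1)n$ matrix with rows and columns indexed by the vertices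 $v_i^t$ with $1<t\le k$, where $D$ is the diagonal matrix with $D[v_i^t,v_i^t]=\sum_{e\text{ leaving }v_i^t}\mathrm{wt}(e)$ and $$A[v_i^t,v_j^r]=\sum_{e=(v_i^t,v_j^r)}\mathrm{wt}(e)-\sum_{e=(v_i^t,v_j^1)}\mathrm{wt}(e).$$ Then for every vertex $v$ of $\Gamma$ and every lift $\tilde v$ of $v$: 1. In $R$ one has $k\,A_{\tilde v}(\tilde\Gamma)=A_v(\Gamma)\cdot\det[\mathscr L(\Gamma)]_{\mathbb Z[E]}$. Consequently, in every field $K$ with a ring homomorphism $R\to K$ such that $k\ne0$ in $K$ and the image of $A_v(\Gamma)$ in $K$ is nonzero (for instance in $K=\mathbb Q(E)$, the field of rational functions in indeterminate weights, when $\Gamma$ has an arborescence rooted at $v$), $$\frac{A_{\tilde v}(\tilde\Gamma)}{A_v(\Gamma)}=\frac1k\det[\mathscr L(\Gamma)]_{\mathbb Z[E]}.$$ 2. Suppose the cover is regular in the sense that it is the derived graph of a voltage assignment $\nu\colon E\to G$ in a finite group $G$: the lifts of each $v$ are labelled $v^h$, $h\in G$, and the lifts of an edge $e$ from $v$ to $w$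 are edges from $v^h$ to $w^{\nu(e)h}$, $h\in G$. Let $\overline{R[G]}=R[G]/\langle\sum_{g\in G}g\rangle$ be the reduced group algebra and let $\mathscr L(\Gamma)$ be the voltage Laplacian, the matrix over $\overline{R[G]}$ with entries $\mathscr L_{ij}=\delta_{ij}\sum_{e\text{ leaving }v_i}\mathrm{wt}(e)-\sum_{e=(v_i,v_j)}\nu(e)\,\mathrm{wt}(e)$. Regard $\mathscr L(\Gamma)$ as the $R$-linear endomorphism $v_i\,c\mapsto\sum_j v_j\,(\mathscr L_{ij}c)$ of the free right $\overline{R[G]}$-module with basis $v_1,\dots,v_n$. Then the elements $v_i\,g$ with $1\ne g\in G$ form an $R$-basis of this module, in which the endomorphism has the matrix $[\mathscr L(\Gamma)]_{\mathbb Z[E]}$ (rows being the images of the basis vectors, and the lift $v_i^{1_G}$ playing the role of $v_i^1$), and $\det[\mathscr L(\Gamma)]_{\mathbb Z[E]}$, formed with any labelling of the lifts, is the determinant of this endomorphism. -/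

import Mathlib

/-- A directed multigraph (loops and parallel edges allowed) with vertex type `V` and edge
type `E`, whose edges carry weights in `R`. -/
structure WeightedDigraph (V E R : Type*) where
  /-- the source of an edge -/
  src : E → V
  /-- the target of an edge -/
  tgt : E → V
  /-- the weight of an edge -/
  wt : E → R

namespace WeightedDigraph

section Arborescence

variable {V E R : Type*}

/-- `Γ.IsWalk w p v`: the list of edges `p` is a directed walk from `w` to `v`. -/
def IsWalk (Γ : WeightedDigraph V E R) : V → List E → V → Prop
  | w, [], v => w = v
  | w, e :: p, v => Γ.src e = w ∧ Γ.IsWalk (Γ.tgt e) p v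

/-- `T` is an arborescence rooted at `v`: a spanning tree directed towards `v`, i.e. from every
vertex `w` there is exactly one directed walk to `v` with edges in `T`. Walks may repeat vertices,
so uniqueness excludes every cycle (and loop), every edge leaving `v`, and
a second edge leaving any vertex `w ≠ v`. -/
def IsArborescence (Γ : WeightedDigraph V E R) (v : V) (T : Finset E) : Prop :=
  ∀ w : V, ∃! p : List E, Γ.IsWalk w p v ∧ ∀ e ∈ p, e ∈ T

open Classical in
/-- `A_v(Γ)`: the sum over all arborescences `T` rooted at `v` of the product of the weights of
the edges of `T`. -/
noncomputable def arbSum [Fintype E] [CommRing R] (Γ : WeightedDigraph V E R) (v : V) : R :=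
  ∑ T : Finset E with Γ.IsArborescence v T, ∏ e ∈ T, Γ.wt e

open Classical in
/-- The sum of the weights of the edges leaving `v`. -/
noncomputable def outWeight [Fintype E] [CommRing R] (Γ : WeightedDigraph V E R) (v : V) : R :=
  ∑ e : E with Γ.src e = v, Γ.wt e

open Classical in
/-- The sum of the weights of the edges from `v` to `w`. -/
noncomputable def edgeWeight [Fintype E] [CommRing R] (Γ : WeightedDigraph V E R) (v w : V) : R :=
  ∑ e : E with Γ.src e = v ∧ Γ.tgt e = w, Γ.wt e

end Arborescence

section Cover

variable {V E V' E' R : Type*}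

/-- `Γ'` together with this projection is a `k`-fold cover of `Γ` with lifted edge weights. -/
structure Cover (Γ' : WeightedDigraph V' E' R) (Γ : WeightedDigraph V E R) (k : ℕ) where
  /-- the projection on vertices -/
  onV : V' → V
  /-- the projection on edges -/
  onE : E' → E
  /-- the projection is a morphism of directed graphs -/
  src_onE : ∀ e, Γ.src (onE e) = onV (Γ'.src e)
  tgt_onE : ∀ e, Γ.tgt (onE e) = onV (Γ'.tgt e)
  /-- every vertex and every edge has exactly `k` lifts -/
  card_vertexFiber : ∀ v, Nat.card {w // onV w = v} = k
  card_edgeFiber : ∀ e, Nat.card {f // onE f = e} = k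
  /-- a lifted edge has the weight of its base edge -/
  wt_eq : ∀ e, Γ'.wt e = Γ.wt (onE e)
  /-- local homeomorphism: the edges leaving (entering) a vertex `w` of the cover are mapped
  bijectively onto the edges leaving (entering) its projection -/
  bijOn_out : ∀ w, Set.BijOn onE {e | Γ'.src e = w} {e | Γ.src e = onV w}
  bijOn_in : ∀ w, Set.BijOn onE {e | Γ'.tgt e = w} {e | Γ.tgt e = onV w}

/-- A labelling of each fibre of the cover by the elements of `I`: the lift of `v` with
label `t` is `lift (v, t)`, written `v^t`. -/
structure Cover.Labelling {Γ' : WeightedDigraph V' E' R} {Γ : WeightedDigraph V E R} {k : ℕ}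
    (π : Cover Γ' Γ k) (I : Type*) where
  /-- the vertex `v^t` of the cover -/
  lift : V × I ≃ V'
  onV_lift : ∀ v t, π.onV (lift (v, t)) = v

namespace Cover.Labelling

variable {Γ' : WeightedDigraph V' E' R} {Γ : WeightedDigraph V E R} {k : ℕ}
  {π : Cover Γ' Γ k} {I : Type*}

/-- Every `k`-fold cover has a labelling by `k` labels. -/
theorem nonempty_fin [Finite V'] (π : Cover Γ' Γ k) : Nonempty (π.Labelling (Fin k)) := by
  have h : ∀ v, Nonempty (Fin k ≃ {w // π.onV w = v}) := fun v =>
    ⟨(Finite.equivFinOfCardEq (π.card_vertexFiber v)).symm⟩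
  let f := fun v => (h v).some
  exact ⟨⟨((Equiv.sigmaEquivProd V (Fin k)).symm.trans (Equiv.sigmaCongrRight f)).trans
    (Equiv.sigmaFiberEquiv π.onV), fun v t => (f v t).2⟩⟩

/-- The matrix `A`, with rows and columns indexed by the vertices `v^t`, `t ≠ o`:
`A[i^t, j^r]` is the total weight of the edges `i^t → j^r` minus that of the edges `i^t → j^o`. -/
noncomputable def adjMatrix [Fintype E'] [CommRing R] (S : π.Labelling I) (o : I) :
    Matrix (V × {t : I // t ≠ o}) (V × {t : I // t ≠ o}) R :=
  fun x y => Γ'.edgeWeight (S.lift (x.1, x.2)) (S.lift (y.1, y.2))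
    - Γ'.edgeWeight (S.lift (x.1, x.2)) (S.lift (y.1, o))

open Classical in
/-- The diagonal matrix `D` of weighted out-degrees of the vertices `v^t`, `t ≠ o`. -/
noncomputable def degMatrix [Fintype E'] [CommRing R] (S : π.Labelling I) (o : I) :
    Matrix (V × {t : I // t ≠ o}) (V × {t : I // t ≠ o}) R :=
  Matrix.diagonal fun x => Γ'.outWeight (S.lift (x.1, x.2))

/-- The `(k - 1)n × (k - 1)n` matrix `[𝓛(Γ)] = D - A`. -/
noncomputable def reducedLaplacian [Fintype E'] [CommRing R] (S : π.Labelling I) (o : I) :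
    Matrix (V × {t : I // t ≠ o}) (V × {t : I // t ≠ o}) R :=
  S.degMatrix o - S.adjMatrix o

/-- The labelling `S` by a group `G` exhibits the cover as the derived graph of the voltage
assignment `ν : E → G`: the lifts of an edge `e : v → w` are the edges `v^h → w^(ν(e)h)`. -/
def IsDerived {G : Type*} [Group G] (S : π.Labelling G) (ν : E → G) : Prop :=
  ∀ (e : E') (h : G), Γ'.src e = S.lift (Γ.src (π.onE e), h) →
    Γ'.tgt e = S.lift (Γ.tgt (π.onE e), ν (π.onE e) * h)

end Cover.Labelling

end Cover

section Voltage

/-- The element `∑ g` of the group algebra. -/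
noncomputable def groupSum (R G : Type*) [CommRing R] [Group G] [Fintype G] : MonoidAlgebra R G :=
  ∑ g : G, MonoidAlgebra.of R G g

theorem groupSum_comm (R G : Type*) [CommRing R] [Group G] [Fintype G] (x : MonoidAlgebra R G) :
    groupSum R G * x = x * groupSum R G := by
  induction x using MonoidAlgebra.induction_on with
  | of g =>
    simp only [groupSum, Finset.sum_mul, Finset.mul_sum, ← map_mul]
    exact (Fintype.sum_equiv (Equiv.mulRight g) _ (fun x => MonoidAlgebra.of R G x)
      (fun _ => rfl)).trans (Fintype.sum_equiv (Equiv.mulLeft g) _ _ (fun _ => rfl)).symm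
  | add x y hx hy => rw [mul_add, add_mul, hx, hy]
  | smul r x hx => rw [mul_smul_comm, smul_mul_assoc, hx]

/-- The ideal of the group algebra generated by `∑ g`. -/
noncomputable def groupSumIdeal (R G : Type*) [CommRing R] [Group G] [Fintype G] :
    Ideal (MonoidAlgebra R G) :=
  Ideal.span {groupSum R G}

instance (R G : Type*) [CommRing R] [Group G] [Fintype G] : (groupSumIdeal R G).IsTwoSided where
  mul_mem_of_left {a} b ha := by
    obtain ⟨c, rfl⟩ := Ideal.mem_span_singleton'.1 ha
    rw [mul_assoc, groupSum_comm, ← mul_assoc]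
    exact Ideal.mul_mem_left _ _ (Ideal.mem_span_singleton_self _)

/-- The reduced group algebra `R[G] / ⟨∑ g⟩`. -/
abbrev ReducedGroupAlgebra (R G : Type*) [CommRing R] [Group G] [Fintype G] : Type _ :=
  MonoidAlgebra R G ⧸ groupSumIdeal R G

/-- The class of `g` in the reduced group algebra. -/
noncomputable def groupElt (R : Type*) {G : Type*} [CommRing R] [Group G] [Fintype G] (g : G) :
    ReducedGroupAlgebra R G :=
  Ideal.Quotient.mk (groupSumIdeal R G) (MonoidAlgebra.of R G g)

variable {V E R G : Type*} [Fintype V] [Fintype E] [CommRing R] [Group G] [Fintype G]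

open Classical in
/-- The voltage Laplacian: weighted degree matrix minus the voltage adjacency matrix, whose
`(i, j)` entry is the sum of `ν(e) wt(e)` over the edges `e : i → j`. -/
noncomputable def voltageLaplacian (Γ : WeightedDigraph V E R) (ν : E → G) :
    Matrix V V (ReducedGroupAlgebra R G) :=
  Matrix.diagonal (fun i => algebraMap R (ReducedGroupAlgebra R G) (Γ.outWeight i))
    - Matrix.of fun i j => ∑ e : E with Γ.src e = i ∧ Γ.tgt e = j, Γ.wt e • groupElt R (ν e)

/-- The voltage Laplacian as a linear transformation over the base ring `R` (restriction of
scalars) of the free module over the reduced group algebra with basis `V`. The `i`-th row of the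
matrix is the image of the `i`-th basis vector: `i·c ↦ ∑ j, j·(𝓛 i j * c)`. -/
noncomputable def voltageLaplacianMap (Γ : WeightedDigraph V E R) (ν : E → G) :
    (V → ReducedGroupAlgebra R G) →ₗ[R] (V → ReducedGroupAlgebra R G) where
  toFun c j := ∑ i, Γ.voltageLaplacian ν i j * c i
  map_add' c d := by
    funext j
    simp [mul_add, Finset.sum_add_distrib]
  map_smul' r c := by
    funext j
    simp [Finset.smul_sum]

end Voltage

end WeightedDigraph

/-! By the matrix-tree theorem an arborescence sum is the determinant of the Laplacian with the
root's row replaced by a unit vector. In the cover, adding up the rows of the Laplacian over a fibre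
gives the base Laplacian pulled back to the cover. Hence row operations (add all rows `i^t` to row
`i^o`) followed by column operations (subtract column `j^o` from each `j^r`) make it block
triangular, with diagonal blocks the base Laplacian and `D - A`; this is
`det_eq_det_mul_det_of_fiber_sum`.

The factor `k` comes from the root. A Laplacian has zero row sums, so replacing one row by `r`
yields the entry sum of `r` times the arborescence sum. Take for `r` the row that makes the fibre of
the root sum to the pulled-back unit vector: its entry sum is `k`, and the block elimination yields
`A_v(Γ) · det (D - A)`. Independence of the labelling follows by comparing characteristic
polynomials, which can be cancelled because they are monic.

For a derived cover, the relation `∑ g = 0` eliminates the identity of `G`, and this elimination is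
exactly the subtraction of the edges into `v_j^1`. -/

namespace Matrix

/-! ### Determinant identities over a commutative ring -/

variable {m R : Type*} [Fintype m] [DecidableEq m] [CommRing R]

/-- Multiplying by the adjugate gives `det M • x = 0`. A coordinate equal to 1, rather than just `x
≠ 0`, is needed because `R` may have zero divisors. -/
theorem det_eq_zero_of_mulVec_eq_zero_of_apply_eq_one {M : Matrix m m R} {x : m → R} {i : m}
    (hx : x i = 1) (h : M *ᵥ x = 0) : M.det = 0 := by
  have h1 : M.adjugate *ᵥ (M *ᵥ x) = M.det • x := by
    rw [mulVec_mulVec, adjugate_mul, smul_mulVec, one_mulVec]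
  have h2 := congrFun h1 i
  simpa [h, hx] using h2.symm

/-- The row `r - (∑ r) e_i` has entry sum zero, so with it in place the matrix still kills the
all-ones vector; linearity in row `i` does the rest. -/
theorem det_updateRow_of_mulVec_one_eq_zero {M : Matrix m m R} (hM : M *ᵥ 1 = 0) (i : m)
    (r : m → R) :
    (M.updateRow i r).det = (∑ j, r j) * (M.updateRow i (Pi.single i 1)).det := by
  have h0 : (M.updateRow i (r + (-∑ j, r j) • Pi.single i 1)).det = 0 := by
    refine det_eq_zero_of_mulVec_eq_zero_of_apply_eq_one (x := 1) (i := i) rfl ?_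
    rw [updateRow_mulVec, hM]
    ext j
    by_cases hj : j = i
    · subst hj
      simp [dotProduct, Finset.sum_add_distrib, ← Finset.mul_sum]
    · simp [hj]
  rw [det_updateRow_add, det_updateRow_smul] at h0
  linear_combination h0

theorem det_eq_det_mul_det_of_fiber_sum {V I : Type*} [Fintype V] [DecidableEq V] [Fintype I]
    [DecidableEq I] (N : Matrix (V × I) (V × I) R) (B : Matrix V V R) (o : I)
    (h : ∀ i j r, ∑ t, N (i, t) (j, r) = B i j) :
    N.det = B.det * (of fun x y : V × {t : I // t ≠ o} =>
      N (x.1, x.2) (y.1, y.2) - N (x.1, x.2) (y.1, o)).det := by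
  let f : V ⊕ V × {t : I // t ≠ o} → V × I := Sum.elim (fun i => (i, o)) fun x => (x.1, x.2)
  have hf : Function.Bijective f := by
    refine ⟨?_, ?_⟩
    · rintro (a | ⟨a, t, ht⟩) (b | ⟨b, s, hs⟩) hab <;> simp [f] at hab ⊢
      · exact hab
      · exact hs hab.2.symm
      · exact ht hab.2
      · exact hab
    · rintro ⟨i, t⟩
      by_cases ht : t = o
      · exact ⟨.inl i, by simp [f, ht]⟩
      · exact ⟨.inr (i, ⟨t, ht⟩), rfl⟩
  let N₁₁ : Matrix V V R := of fun i j => N (i, o) (j, o)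
  let N₁₂ : Matrix V (V × {t : I // t ≠ o}) R := of fun i y => N (i, o) (y.1, y.2)
  let N₂₁ : Matrix (V × {t : I // t ≠ o}) V R := of fun x j => N (x.1, x.2) (j, o)
  let N₂₂ : Matrix (V × {t : I // t ≠ o}) (V × {t : I // t ≠ o}) R :=
    of fun x y => N (x.1, x.2) (y.1, y.2)
  let U : Matrix V (V × {t : I // t ≠ o}) R := of fun i x => if i = x.1 then 1 else 0
  have hN : N.submatrix f f = fromBlocks N₁₁ N₁₂ N₂₁ N₂₂ := by
    ext (i | x) (j | y) <;> rfl
  have hsum (i j r) : N (i, o) (j, r) + ∑ t : {t : I // t ≠ o}, N (i, t) (j, r) = B i j := by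
    rw [← h i j r]
    exact (Fintype.sum_eq_add_sum_subtype_ne (fun t => N (i, t) (j, r)) o).symm
  have hU (i : V) (a : V × {t : I // t ≠ o} → R) : ∑ x, U i x * a x = ∑ t, a (i, t) := by
    simp [U, Fintype.sum_prod_type_right]
  have h₁₁ : N₁₁ + U * N₂₁ = B := by
    ext i j
    exact (congrArg (N (i, o) (j, o) + ·) (hU i fun x => N₂₁ x j)).trans (hsum i j o)
  have h₁₂ : N₁₂ + U * N₂₂ = B * U := by
    ext i y
    refine (congrArg (N (i, o) (y.1, y.2) + ·) (hU i fun x => N₂₂ x y)).trans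
      ((hsum i y.1 y.2).trans ?_)
    simp [U, mul_apply]
  have h₂₂ : N₂₂ - N₂₁ * U = of fun x y : V × {t : I // t ≠ o} =>
      N (x.1, x.2) (y.1, y.2) - N (x.1, x.2) (y.1, o) := by
    ext x y
    simp [N₂₂, N₂₁, U, mul_apply]
  -- The left factor adds the rows `i^t` to row `i^o`; the right factor subtracts column `j^o` from
  -- the columns `j^r`. Both are unitriangular. The upper right block vanishes because the fibre
  -- sums do not depend on `r`.
  have key : fromBlocks 1 U 0 1 * fromBlocks N₁₁ N₁₂ N₂₁ N₂₂ * fromBlocks 1 (-U) 0 1 =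
      fromBlocks B 0 N₂₁ (N₂₂ - N₂₁ * U) := by
    rw [fromBlocks_multiply, fromBlocks_multiply]
    simp only [Matrix.one_mul, Matrix.zero_mul, Matrix.mul_one, Matrix.mul_zero, zero_add,
      add_zero, h₁₁, h₁₂, Matrix.mul_neg, neg_add_cancel]
    congr 1
    abel
  have hdet := congrArg det key
  rw [det_mul, det_mul, det_fromBlocks_zero₂₁, det_fromBlocks_zero₂₁, det_fromBlocks_zero₁₂,
    ← hN, h₂₂] at hdet
  rw [← hdet, det_one, det_one, one_mul, one_mul, mul_one]
  exact (det_submatrix_equiv_self (Equiv.ofBijective f hf) N).symm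

end Matrix

open Matrix

/-- `g` is a parent map of a forest, with `none` at roots, and `b` is a height. Ordered by `b` the
matrix is triangular with identity diagonal blocks. -/
theorem Matrix.det_one_sub_parent_eq_one {V R : Type*} [Fintype V] [DecidableEq V] [CommRing R]
    (g : V → Option V) (b : V → ℕ) (hb : ∀ w u, g w = some u → b u < b w) :
    (of fun w j : V => (Pi.single w 1 - (g w).elim 0 (Pi.single · 1) : V → R) j).det = 1 := by
  have htri : BlockTriangular
      (of fun w j : V => (Pi.single w 1 - (g w).elim 0 (Pi.single · 1) : V → R) j)
      (OrderDual.toDual ∘ b) := by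
    intro i j hij
    have hij' : b i < b j := hij
    have hne : j ≠ i := by rintro rfl; exact lt_irrefl _ hij'
    cases hg : g i with
    | none => simp [hg, hne]
    | some u =>
      have : j ≠ u := by rintro rfl; exact lt_asymm hij' (hb _ _ hg)
      simp [hg, hne, this]
  rw [htri.det]
  refine Finset.prod_eq_one fun a _ => ?_
  refine (congrArg det ?_).trans det_one
  ext ⟨i, hi⟩ ⟨j, hj⟩
  have hij : b i = b j := OrderDual.toDual.injective (hi.trans hj.symm)
  rw [one_apply, toSquareBlock_def]
  cases hg : g i with
  | none => simp [hg, Pi.single_apply, eq_comm]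
  | some u =>
    have : j ≠ u := by rintro rfl; exact (hb _ _ hg).ne hij.symm
    simp [hg, this, Pi.single_apply, eq_comm]

namespace WeightedDigraph

variable {V E R : Type*}

/-! ### Arborescences as choices of one outgoing edge per non-root vertex -/

section Walks

variable (Γ : WeightedDigraph V E R) {v : V}

/-- The edges selected by a partial choice of an edge at each vertex. -/
def choiceSet [Fintype E] [DecidableEq E] (r : V → Option E) : Finset E :=
  Finset.univ.filter fun e => r (Γ.src e) = some e

/-- A partial choice of edges that selects no edge at `v` and an outgoing edge at each other
vertex. -/
def IsChoice (v : V) (r : V → Option E) : Prop :=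
  r v = none ∧ ∀ w, w ≠ v → ∃ e, r w = some e ∧ Γ.src e = w

variable {Γ}

theorem IsChoice.src_eq {r : V → Option E} (hr : Γ.IsChoice v r) {w : V} {e : E}
    (h : r w = some e) : Γ.src e = w := by
  by_cases hw : w = v
  · subst hw
    simp [hr.1] at h
  · obtain ⟨f, hf, hs⟩ := hr.2 w hw
    rw [h] at hf
    cases hf
    exact hs

theorem IsWalk.cons {e : E} {p : List E} (h : Γ.IsWalk (Γ.tgt e) p v) :
    Γ.IsWalk (Γ.src e) (e :: p) v :=
  ⟨rfl, h⟩

variable [Fintype E] [DecidableEq E]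

theorem mem_choiceSet {r : V → Option E} {e : E} :
    e ∈ Γ.choiceSet r ↔ r (Γ.src e) = some e := by
  simp [choiceSet]

theorem IsChoice.mem_choiceSet_iff {r : V → Option E} (hr : Γ.IsChoice v r) {w : V} {e : E} :
    r w = some e ↔ Γ.src e = w ∧ e ∈ Γ.choiceSet r := by
  rw [mem_choiceSet]
  constructor
  · intro h
    have := hr.src_eq h
    exact ⟨this, this ▸ h⟩
  · rintro ⟨rfl, h⟩
    exact h

theorem IsChoice.eq_of_choiceSet_eq {r s : V → Option E} (hr : Γ.IsChoice v r)
    (hs : Γ.IsChoice v s) (h : Γ.choiceSet r = Γ.choiceSet s) : r = s := by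
  funext w
  refine Option.ext fun e => ?_
  rw [hr.mem_choiceSet_iff, hs.mem_choiceSet_iff, h]

/-- No selected edge leaves `v` and at most one leaves any other vertex, so two walks agree edge by
edge and stop together. -/
theorem IsChoice.walk_unique {r : V → Option E} (hr : Γ.IsChoice v r) :
    ∀ (w : V) (p q : List E), (Γ.IsWalk w p v ∧ ∀ e ∈ p, e ∈ Γ.choiceSet r) →
      (Γ.IsWalk w q v ∧ ∀ e ∈ q, e ∈ Γ.choiceSet r) → p = q := by
  have hroot (e : E) (he : e ∈ Γ.choiceSet r) : Γ.src e ≠ v := by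
    intro h
    rw [mem_choiceSet, h, hr.1] at he
    cases he
  intro w p
  induction p generalizing w with
  | nil =>
    rintro (_ | ⟨e, q⟩) ⟨hp, -⟩ ⟨hq, hqT⟩
    · rfl
    · exact absurd (hq.1.trans hp) (hroot e (hqT e List.mem_cons_self))
  | cons e p ih =>
    rintro (_ | ⟨f, q⟩) ⟨hp, hpT⟩ ⟨hq, hqT⟩
    · exact absurd (hp.1.trans hq) (hroot e (hpT e List.mem_cons_self))
    · have he := mem_choiceSet.1 (hpT e List.mem_cons_self)
      have hf := mem_choiceSet.1 (hqT f List.mem_cons_self)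
      rw [hp.1] at he
      rw [hq.1, he] at hf
      cases hf
      rw [ih _ q ⟨hp.2, fun x hx => hpT x (List.mem_cons_of_mem _ hx)⟩
        ⟨hq.2, fun x hx => hqT x (List.mem_cons_of_mem _ hx)⟩]

theorem IsChoice.isArborescence_iff {r : V → Option E} (hr : Γ.IsChoice v r) :
    Γ.IsArborescence v (Γ.choiceSet r) ↔
      ∀ w, ∃ p, Γ.IsWalk w p v ∧ ∀ e ∈ p, e ∈ Γ.choiceSet r :=
  ⟨fun h w => (h w).exists, fun h w => existsUnique_of_exists_of_unique (h w)
    fun p q hp hq => hr.walk_unique w p q hp hq⟩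

/-- The edge chosen at `w` is the first edge of the unique walk from `w` to `v`. -/
theorem IsArborescence.exists_isChoice {T : Finset E} (h : Γ.IsArborescence v T) :
    ∃ r, Γ.IsChoice v r ∧ Γ.choiceSet r = T := by
  choose p hp hu using h
  have hv : p v = [] := (hu v [] ⟨rfl, by simp⟩).symm
  -- Prepending `e` to the walk from its target gives a walk from its source, which by uniqueness is
  -- the chosen one.
  have hT (e : E) (he : e ∈ T) : p (Γ.src e) = e :: p (Γ.tgt e) := by
    refine (hu _ _ ⟨(hp (Γ.tgt e)).1.cons, ?_⟩).symm
    simpa [he] using (hp (Γ.tgt e)).2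
  refine ⟨fun w => (p w).head?, ⟨by simp [hv], fun w hw => ?_⟩, ?_⟩
  · cases hpw : p w with
    | nil =>
      have := (hp w).1
      rw [hpw] at this
      exact absurd this hw
    | cons e q =>
      have := (hp w).1
      rw [hpw] at this
      exact ⟨e, by simp [hpw], this.1⟩
  · ext e
    rw [mem_choiceSet]
    constructor
    · intro h
      exact (hp _).2 e (List.mem_of_mem_head? h)
    · intro h
      simp [hT e h]

theorem IsChoice.prod_choiceSet [Fintype V] [CommRing R] {r : V → Option E}
    (hr : Γ.IsChoice v r) : ∏ e ∈ Γ.choiceSet r, Γ.wt e = ∏ w, (r w).elim 1 Γ.wt := by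
  classical
  rw [← Finset.prod_fiberwise (Γ.choiceSet r) Γ.src]
  refine Finset.prod_congr rfl fun w _ => ?_
  cases h : r w with
  | none =>
    refine Finset.prod_eq_one fun e he => ?_
    rw [Finset.mem_filter, and_comm, ← hr.mem_choiceSet_iff, h] at he
    cases he
  | some f =>
    have : (Γ.choiceSet r).filter (fun e => Γ.src e = w) = {f} := by
      ext e
      rw [Finset.mem_filter, and_comm, ← hr.mem_choiceSet_iff, h]
      simp [eq_comm]
    simp [this]

/-- For an arborescence, the length of the walk to the root is a height decreasing along parents.
Otherwise the indicator of the vertices that cannot reach `v` lies in the kernel: a non-root vertex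
reaches `v` exactly when its parent does. -/
theorem IsChoice.det_parent [Fintype V] [DecidableEq V] (S : Type*) [CommRing S]
    {r : V → Option E} (hr : Γ.IsChoice v r) [Decidable (Γ.IsArborescence v (Γ.choiceSet r))] :
    (of fun w j : V =>
      (Pi.single w 1 - ((r w).map Γ.tgt).elim 0 (Pi.single · 1) : V → S) j).det =
      if Γ.IsArborescence v (Γ.choiceSet r) then 1 else 0 := by
  classical
  split_ifs with h
  · choose p hp hu using h
    refine det_one_sub_parent_eq_one _ (fun w => (p w).length) fun w u hwu => ?_
    obtain ⟨e, he, rfl⟩ := Option.map_eq_some_iff.1 hwu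
    obtain ⟨hs, heT⟩ := hr.mem_choiceSet_iff.1 he
    have : p w = e :: p (Γ.tgt e) := by
      refine (hu _ _ ⟨hs ▸ (hp (Γ.tgt e)).1.cons, ?_⟩).symm
      simpa [heT] using (hp (Γ.tgt e)).2
    simp [this]
  · rw [hr.isArborescence_iff] at h
    push Not at h
    obtain ⟨w₀, hw₀⟩ := h
    let P : V → Prop := fun w => ∃ p, Γ.IsWalk w p v ∧ ∀ e ∈ p, e ∈ Γ.choiceSet r
    have hP₀ : ¬ P w₀ := fun ⟨p, h1, h2⟩ => by
      obtain ⟨e, he, he'⟩ := hw₀ p h1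
      exact he' (h2 e he)
    have hPv : P v := ⟨[], rfl, by simp⟩
    refine det_eq_zero_of_mulVec_eq_zero_of_apply_eq_one
      (x := fun w => if P w then 0 else 1) (i := w₀) (by simp [hP₀]) ?_
    ext w
    change (Pi.single w 1 - ((r w).map Γ.tgt).elim 0 (Pi.single · 1) : V → S) ⬝ᵥ
      (fun w => if P w then 0 else 1) = 0
    rw [sub_dotProduct, single_one_dotProduct]
    cases he : r w with
    | none =>
      have hw : w = v := by
        by_contra hne
        obtain ⟨e, h1, -⟩ := hr.2 w hne
        simp [h1] at he
      subst hw
      simp [hPv]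
    | some e =>
      obtain ⟨hs, heT⟩ := hr.mem_choiceSet_iff.1 he
      have hiff : P w ↔ P (Γ.tgt e) := by
        constructor
        · rintro ⟨_ | ⟨f, p⟩, h1, h2⟩
          · have hw : w = v := h1
            rw [hw, hr.1] at he
            cases he
          · have hf := hr.mem_choiceSet_iff.2 ⟨h1.1, h2 f List.mem_cons_self⟩
            rw [he] at hf
            cases hf
            exact ⟨p, h1.2, fun x hx => h2 x (List.mem_cons_of_mem _ hx)⟩
        · rintro ⟨p, h1, h2⟩
          exact ⟨e :: p, ⟨hs, h1⟩, by simpa [heT] using h2⟩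
      simp [hiff]

end Walks

/-! ### The matrix-tree theorem -/

section MatrixTree

variable [DecidableEq V] [Fintype E] [CommRing R]

/-- The Laplacian matrix of a weighted directed multigraph. -/
noncomputable def laplacian (Γ : WeightedDigraph V E R) : Matrix V V R :=
  diagonal Γ.outWeight - of Γ.edgeWeight

theorem laplacian_apply (Γ : WeightedDigraph V E R) (i j : V) :
    Γ.laplacian i j = (if i = j then Γ.outWeight i else 0) - Γ.edgeWeight i j := by
  simp [laplacian, diagonal_apply]

/-- Writes each row as a sum over outgoing edges, the form to which multilinearity of the
determinant applies. A loop contributes zero. -/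
theorem laplacian_row (Γ : WeightedDigraph V E R) (w : V) :
    Γ.laplacian w = ∑ e : E with Γ.src e = w,
      Γ.wt e • (Pi.single w 1 - Pi.single (Γ.tgt e) 1 : V → R) := by
  classical
  ext j
  simp only [laplacian_apply, outWeight, edgeWeight, Finset.sum_apply,
    Pi.smul_apply, Pi.sub_apply, smul_eq_mul, mul_sub, Finset.sum_sub_distrib]
  congr 1
  · by_cases h : w = j
    · subst h
      simp only [if_true, Pi.single_eq_same, mul_one]
      congr!
    · simp [h]
  · rw [← Finset.filter_filter, Finset.sum_filter]
    simp [Pi.single_apply, eq_comm]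

variable [Fintype V]

/-- The matrix-tree theorem for directed multigraphs. -/
theorem arbSum_eq_det (Γ : WeightedDigraph V E R) (v : V) :
    Γ.arbSum v = (Γ.laplacian.updateRow v (Pi.single v 1)).det := by
  classical
  let A : V → Finset (Option E) := fun w =>
    if w = v then {none} else (Finset.univ.filter fun e => Γ.src e = w).image some
  -- The row contributed by option `o` at `w`. At the root the only option is `none`, with weight 1
  -- and row `e_v`, which accounts for the replaced row.
  let g : V → Option E → V → R := fun w o =>
    o.elim 1 Γ.wt • (Pi.single w 1 - (o.map Γ.tgt).elim 0 (Pi.single · 1) : V → R)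
  have hA (r : V → Option E) : r ∈ Fintype.piFinset A ↔ Γ.IsChoice v r := by
    rw [Fintype.mem_piFinset]
    constructor
    · refine fun h => ⟨by simpa [A] using h v, fun w hw => ?_⟩
      obtain ⟨e, h1, h2⟩ := by simpa [A, hw] using h w
      exact ⟨e, h2.symm, h1⟩
    · rintro ⟨h1, h2⟩ w
      by_cases hw : w = v
      · simp [A, hw, h1]
      · obtain ⟨e, he, hs⟩ := h2 w hw
        simpa [A, hw, he] using hs
  have hrows : Γ.laplacian.updateRow v (Pi.single v 1) = fun w => ∑ o ∈ A w, g w o := by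
    funext w
    by_cases hw : w = v
    · subst hw
      rw [updateRow_self]
      simp [A, g]
    · rw [updateRow_ne hw, laplacian_row]
      simp [A, g, hw]
  have hexp : (Γ.laplacian.updateRow v (Pi.single v 1)).det =
      ∑ r ∈ Fintype.piFinset A, (of fun w => g w (r w)).det := by
    rw [hrows]
    exact (detRowAlternating (R := R) (n := V)).toMultilinearMap.map_sum_finset g A
  have hterm (r : V → Option E) (hr : r ∈ Fintype.piFinset A) :
      (of fun w => g w (r w)).det =
        if Γ.IsArborescence v (Γ.choiceSet r) then ∏ e ∈ Γ.choiceSet r, Γ.wt e else 0 := by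
    have hr' := (hA r).1 hr
    rw [hr'.prod_choiceSet]
    refine (det_mul_column (fun w => (r w).elim 1 Γ.wt) (of fun w j : V =>
      (Pi.single w 1 - ((r w).map Γ.tgt).elim 0 (Pi.single · 1) : V → R) j)).trans ?_
    rw [hr'.det_parent R, mul_ite, mul_one, mul_zero]
  rw [hexp, Finset.sum_congr rfl hterm, ← Finset.sum_filter, arbSum]
  symm
  refine Finset.sum_bij (fun r _ => Γ.choiceSet r) ?_ ?_ ?_ fun _ _ => rfl
  · intro r hr
    simpa using (Finset.mem_filter.1 hr).2
  · intro r hr s hs h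
    exact ((hA r).1 (Finset.mem_filter.1 hr).1).eq_of_choiceSet_eq
      ((hA s).1 (Finset.mem_filter.1 hs).1) h
  · intro T hT
    have hT' := (Finset.mem_filter.1 hT).2
    obtain ⟨r, hr, rfl⟩ := hT'.exists_isChoice
    exact ⟨r, Finset.mem_filter.2 ⟨(hA r).2 hr, hT'⟩, rfl⟩

theorem laplacian_mulVec_one (Γ : WeightedDigraph V E R) : Γ.laplacian *ᵥ 1 = 0 := by
  ext w
  change Γ.laplacian w ⬝ᵥ 1 = 0
  rw [laplacian_row, dotProduct_one]
  simp [Finset.sum_apply, ← Finset.mul_sum, Finset.sum_comm (s := Finset.univ (α := V))]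

end MatrixTree

end WeightedDigraph

/-! ### The Laplacian of a cover -/

namespace WeightedDigraph

variable {V E V' E' R I : Type*} {Γ' : WeightedDigraph V' E' R} {Γ : WeightedDigraph V E R}
  {k : ℕ}

theorem Cover.outWeight_eq [Fintype E] [Fintype E'] [CommRing R] (π : Cover Γ' Γ k) (w : V') :
    Γ'.outWeight w = Γ.outWeight (π.onV w) := by
  classical
  have h := π.bijOn_out w
  refine Finset.sum_nbij π.onE ?_ ?_ ?_ fun e _ => π.wt_eq e
  · intro e he
    simpa using h.mapsTo (by simpa using he)
  · simpa using h.injOn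
  · simpa using h.surjOn

namespace Cover.Labelling

variable {π : Cover Γ' Γ k}

theorem card_eq [Fintype I] (S : π.Labelling I) (v : V) : Fintype.card I = k := by
  rw [← π.card_vertexFiber v, ← Nat.card_eq_fintype_card]
  refine Nat.card_congr (Equiv.ofBijective (fun t => ⟨S.lift (v, t), S.onV_lift v t⟩) ⟨?_, ?_⟩)
  · intro s t h
    simpa using h
  · rintro ⟨w, hw⟩
    obtain ⟨⟨u, t⟩, rfl⟩ := S.lift.surjective w
    rw [S.onV_lift] at hw
    subst hw
    exact ⟨t, rfl⟩

theorem card_vertices [Fintype V] [Fintype V'] [Fintype I] [DecidableEq I] (S : π.Labelling I) (o : I) :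
    Fintype.card (V × {t : I // t ≠ o}) = Fintype.card V' - Fintype.card V := by
  have h : Fintype.card {t : I // t ≠ o} = Fintype.card I - 1 := by simp
  rw [← Fintype.card_congr S.lift, Fintype.card_prod, Fintype.card_prod, h, Nat.mul_sub_one]

variable [Fintype E'] [CommRing R]

/-- The edges entering `w` biject with those entering its projection; summing over `t` only requires
the source to lie above `i`. -/
theorem sum_edgeWeight [Fintype E] [Fintype I] (S : π.Labelling I) (i : V) (w : V') :
    ∑ t, Γ'.edgeWeight (S.lift (i, t)) w = Γ.edgeWeight i (π.onV w) := by
  classical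
  have h1 : ∑ t, Γ'.edgeWeight (S.lift (i, t)) w =
      ∑ e : E' with π.onV (Γ'.src e) = i ∧ Γ'.tgt e = w, Γ'.wt e := by
    simp only [edgeWeight, Finset.sum_filter]
    rw [Finset.sum_comm]
    refine Finset.sum_congr rfl fun e _ => ?_
    obtain ⟨⟨u, s⟩, hs⟩ := S.lift.surjective (Γ'.src e)
    rw [← hs, S.onV_lift]
    by_cases hu : u = i <;> by_cases hw : Γ'.tgt e = w <;> simp [hu, hw]
  rw [h1]
  have h := π.bijOn_in w
  refine Finset.sum_nbij π.onE ?_ ?_ ?_ fun e _ => π.wt_eq e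
  · intro e he
    have he' := (Finset.mem_filter.1 he).2
    refine Finset.mem_filter.2 ⟨Finset.mem_univ _, ?_, ?_⟩
    · rw [π.src_onE, he'.1]
    · rw [π.tgt_onE, he'.2]
  · refine h.injOn.mono fun e he => ?_
    exact ((Finset.mem_filter.1 he).2).2
  · intro f hf
    have hf' := (Finset.mem_filter.1 hf).2
    obtain ⟨e, he, rfl⟩ := h.surjOn hf'.2
    refine ⟨e, Finset.mem_coe.2 (Finset.mem_filter.2 ⟨Finset.mem_univ _, ?_, he⟩), rfl⟩
    rw [← π.src_onE, hf'.1]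

variable [DecidableEq V] [DecidableEq V'] [DecidableEq I]

theorem sum_laplacian [Fintype E] [Fintype I] (S : π.Labelling I) (i j : V) (r : I) :
    ∑ t, Γ'.laplacian (S.lift (i, t)) (S.lift (j, r)) = Γ.laplacian i j := by
  simp only [laplacian_apply, Finset.sum_sub_distrib, sum_edgeWeight, S.onV_lift,
    EmbeddingLike.apply_eq_iff_eq, π.outWeight_eq, Prod.mk.injEq]
  by_cases h : i = j <;> simp [h]

theorem reducedLaplacian_apply (S : π.Labelling I) (o : I) (x y : V × {t : I // t ≠ o}) :
    S.reducedLaplacian o x y = Γ'.laplacian (S.lift (x.1, x.2)) (S.lift (y.1, y.2)) -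
      Γ'.laplacian (S.lift (x.1, x.2)) (S.lift (y.1, o)) := by
  classical
  obtain ⟨i, s⟩ := x
  obtain ⟨j, t⟩ := y
  simp only [reducedLaplacian, degMatrix, adjMatrix, laplacian_apply, Matrix.sub_apply,
    diagonal_apply, EmbeddingLike.apply_eq_iff_eq, Prod.mk.injEq, s.2, and_false, if_false,
    Subtype.coe_inj]
  by_cases h : i = j ∧ s = t <;> simp [h] <;> ring

variable [Fintype E] [Fintype V] [Fintype V']

/-- The block elimination applies to the characteristic matrix too: the fibre sums of `X • 1` are `X
δ_ij`, and column `j^o` of `X • 1` is zero in the rows `t ≠ o`. -/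
theorem charpoly_laplacian [Fintype I] (S : π.Labelling I) (o : I) :
    Γ'.laplacian.charpoly = Γ.laplacian.charpoly * (S.reducedLaplacian o).charpoly := by
  rw [charpoly, ← det_submatrix_equiv_self S.lift,
    det_eq_det_mul_det_of_fiber_sum _ Γ.laplacian.charmatrix o]
  · rw [charpoly, charpoly]
    congr 2
    ext1 x y
    obtain ⟨i, s⟩ := x
    obtain ⟨j, t⟩ := y
    simp only [of_apply, submatrix_apply, charmatrix_apply, reducedLaplacian_apply,
      diagonal_apply, EmbeddingLike.apply_eq_iff_eq, Prod.mk.injEq, s.2, and_false, if_false,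
      Subtype.coe_inj, map_sub]
    ring
  · intro i j r
    simp only [submatrix_apply, charmatrix_apply, diagonal_apply, EmbeddingLike.apply_eq_iff_eq,
      Prod.mk.injEq, Finset.sum_sub_distrib, ← map_sum, sum_laplacian]
    by_cases h : i = j <;> simp [h]

/-- The factorization of determinants alone would not suffice, since the base Laplacian is singular
when `V` is nonempty. Its characteristic polynomial is monic, hence cancellable over any `R`. -/
theorem det_reducedLaplacian_eq [Fintype I] {J : Type*} [Fintype J] [DecidableEq J]
    (S : π.Labelling I) (o : I) (T : π.Labelling J) (p : J) :
    (S.reducedLaplacian o).det = (T.reducedLaplacian p).det := by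
  have h : (S.reducedLaplacian o).charpoly = (T.reducedLaplacian p).charpoly :=
    Γ.laplacian.charpoly_monic.isRegular.left
      ((S.charpoly_laplacian o).symm.trans (T.charpoly_laplacian p))
  rw [det_eq_sign_charpoly_coeff, det_eq_sign_charpoly_coeff, h, S.card_vertices, T.card_vertices]

theorem natCast_mul_arbSum_lift [Fintype I] (S : π.Labelling I) (o : I) (v : V) :
    (k : R) * Γ'.arbSum (S.lift (v, o)) = Γ.arbSum v * (S.reducedLaplacian o).det := by
  -- Chosen so that, with `ρ` as row `v^o`, the rows above `v` sum to the indicator of the fibre of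
  -- `v`. The other rows `v^t` have entry sum zero, so the entries of `ρ` sum to `k`, the size of
  -- that fibre.
  let ρ : V × I → R := fun y => (if y.1 = v then 1 else 0) -
    ∑ t : {t : I // t ≠ o}, Γ'.laplacian (S.lift (v, t)) (S.lift y)
  let M := Γ'.laplacian.submatrix S.lift S.lift
  have hM : M *ᵥ 1 = 0 := by
    ext x
    have h := congrFun Γ'.laplacian_mulVec_one (S.lift x)
    refine Eq.trans ?_ h
    simp only [mulVec, dotProduct, Pi.one_apply, mul_one, M, submatrix_apply]
    exact S.lift.sum_comp fun w => Γ'.laplacian (S.lift x) w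
  have hrow (i : V) (t : I) : ∑ y, Γ'.laplacian (S.lift (i, t)) (S.lift y) = 0 := by
    simpa [M, mulVec, dotProduct] using congrFun hM (i, t)
  have hρ : ∑ y, ρ y = k := by
    simp only [ρ, Finset.sum_sub_distrib]
    rw [Finset.sum_comm, Finset.sum_eq_zero fun (t : {t : I // t ≠ o}) _ => hrow v (t : I),
      sub_zero]
    rw [Fintype.sum_prod_type_right]
    simp [S.card_eq v]
  have hroot : (M.updateRow (v, o) (Pi.single (v, o) 1)).det = Γ'.arbSum (S.lift (v, o)) := by
    rw [arbSum_eq_det, ← det_submatrix_equiv_self S.lift]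
    congr 1
    ext x y
    by_cases hx : x = (v, o)
    · subst hx
      simp [Pi.single_apply]
    · simp [updateRow_apply, hx, M]
  rw [← hρ, ← hroot, ← det_updateRow_of_mulVec_one_eq_zero hM, arbSum_eq_det,
    det_eq_det_mul_det_of_fiber_sum _ (Γ.laplacian.updateRow v (Pi.single v 1)) o]
  · congr 2
    ext x y
    -- The reduced block only involves rows with label `≠ o`, so the new row `v^o` does not affect
    -- it.
    have hx : (x.1, (x.2 : I)) ≠ (v, o) := fun h => x.2.2 (congrArg Prod.snd h)
    simp only [of_apply, updateRow_ne hx, reducedLaplacian_apply, M, submatrix_apply]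
  · intro i j r
    by_cases hi : i = v
    · subst hi
      rw [Fintype.sum_eq_add_sum_subtype_ne _ o, updateRow_self, updateRow_self]
      rw [Finset.sum_congr rfl fun (t : {t : I // t ≠ o}) _ => congrFun
        (updateRow_ne (M := M) (b := ρ) (i := (i, o)) (i' := (i, (t : I)))
          fun h => t.2 (congrArg Prod.snd h)) (j, r)]
      simp [ρ, M, Pi.single_apply]
    · rw [updateRow_ne hi, ← S.sum_laplacian i j r]
      refine Finset.sum_congr rfl fun t _ => ?_
      rw [updateRow_ne fun h => hi (congrArg Prod.fst h)]
      rfl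

end Cover.Labelling

end WeightedDigraph

namespace WeightedDigraph

/-! ### A basis of the reduced group algebra -/

section ReducedGroupAlgebra

variable (R G : Type*) [CommRing R] [Group G] [Fintype G]

theorem sum_groupElt : ∑ g : G, groupElt R g = 0 := by
  have h : Ideal.Quotient.mk (groupSumIdeal R G) (groupSum R G) = 0 :=
    Ideal.Quotient.eq_zero_iff_mem.2 (Ideal.mem_span_singleton_self _)
  rwa [groupSum, map_sum] at h

theorem coeff_mul_groupSum (a : MonoidAlgebra R G) (g : G) :
    (a * groupSum R G).coeff g = ∑ x, a.coeff x := by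
  simp only [groupSum, Finset.mul_sum, MonoidAlgebra.of_apply, MonoidAlgebra.coeff_sum,
    Finsupp.finsetSum_apply]
  refine Fintype.sum_equiv ((Equiv.inv G).trans (Equiv.mulLeft g)) _ _ fun x => ?_
  simp

/-- Elements of the ideal have constant coefficients. A combination of nontrivial group elements has
coefficient 0 at `1`, so if it lies in the ideal it is zero. -/
theorem linearIndependent_groupElt :
    LinearIndependent R fun g : {g : G // g ≠ 1} => groupElt R (g : G) := by
  classical
  rw [Fintype.linearIndependent_iff]
  intro c hc i
  have hmem : ∑ g : {g : G // g ≠ 1}, c g • MonoidAlgebra.of R G (g : G) ∈ groupSumIdeal R G := by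
    rw [← Ideal.Quotient.eq_zero_iff_mem, map_sum, ← hc]
    rfl
  obtain ⟨a, ha⟩ := Ideal.mem_span_singleton'.1 hmem
  have hcoe (h : G) : (a * groupSum R G).coeff h =
      ∑ g : {g : G // g ≠ 1}, if (g : G) = h then c g else 0 := by
    rw [ha, MonoidAlgebra.coeff_sum, Finsupp.finsetSum_apply]
    refine Finset.sum_congr rfl fun g _ => ?_
    simp [MonoidAlgebra.of_apply, Finsupp.single_apply]
  have h1 := hcoe 1
  have hi := hcoe i
  rw [coeff_mul_groupSum, ← coeff_mul_groupSum R G a 1, h1] at hi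
  rw [Finset.sum_eq_zero fun (g : {g : G // g ≠ 1}) _ => if_neg g.2] at hi
  simpa [Subtype.coe_inj] using hi.symm

theorem span_groupElt :
    ⊤ ≤ Submodule.span R (Set.range fun g : {g : G // g ≠ 1} => groupElt R (g : G)) := by
  classical
  have hg (g : G) :
      groupElt R g ∈
        Submodule.span R (Set.range fun g : {g : G // g ≠ 1} => groupElt R (g : G)) := by
    by_cases h : g = 1
    · subst h
      have := sum_groupElt R G
      rw [Fintype.sum_eq_add_sum_subtype_ne _ (1 : G)] at this
      rw [eq_neg_of_add_eq_zero_left this]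
      exact neg_mem (sum_mem fun g _ => Submodule.subset_span ⟨g, rfl⟩)
    · exact Submodule.subset_span ⟨⟨g, h⟩, rfl⟩
  rintro x -
  obtain ⟨x, rfl⟩ := Ideal.Quotient.mk_surjective x
  induction x using MonoidAlgebra.induction_on with
  | of g => exact hg g
  | add x y hx hy => rw [map_add]; exact add_mem hx hy
  | smul r x hx => exact Submodule.smul_mem _ r hx

/-- The basis of the reduced group algebra consisting of the nontrivial group elements. -/
noncomputable def groupEltBasis :
    Module.Basis {g : G // g ≠ 1} R (ReducedGroupAlgebra R G) :=
  Module.Basis.mk (linearIndependent_groupElt R G) (span_groupElt R G)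

variable (V : Type*) [Fintype V] [DecidableEq V]

/-- The `R`-basis `v_i g`, `g ≠ 1`, of the free module over the reduced group algebra. -/
noncomputable def voltageBasis :
    Module.Basis (V × {g : G // g ≠ 1}) R (V → ReducedGroupAlgebra R G) :=
  (Pi.basis fun _ : V => groupEltBasis R G).reindex (Equiv.sigmaEquivProd V _)

variable {V}

theorem voltageBasis_apply (x : V × {g : G // g ≠ 1}) :
    voltageBasis R G V x = Pi.single x.1 (groupElt R (x.2 : G)) := by
  simp [voltageBasis, groupEltBasis, Pi.basis_apply]

end ReducedGroupAlgebra

/-! ### The voltage Laplacian of a derived cover -/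

theorem groupElt_mul {R G : Type*} [CommRing R] [Group G] [Fintype G] (g h : G) :
    groupElt R g * groupElt R h = groupElt R (g * h) := by
  simp only [groupElt, map_mul]

variable {V E V' E' R G : Type*} [Fintype E] [Fintype E']
  [CommRing R] [Group G] [Fintype G] {Γ' : WeightedDigraph V' E' R} {Γ : WeightedDigraph V E R}
  {k : ℕ} {π : Cover Γ' Γ k}

open Classical in
theorem Cover.Labelling.IsDerived.sum_edgeWeight_smul {S : π.Labelling G} {ν : E → G}
    (hS : S.IsDerived ν) (i j : V) (g : G) :
    ∑ h, Γ'.edgeWeight (S.lift (i, g)) (S.lift (j, h)) • groupElt R h =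
      ∑ e : E with Γ.src e = i ∧ Γ.tgt e = j, Γ.wt e • groupElt R (ν e * g) := by
  have hb := π.bijOn_out (S.lift (i, g))
  have h1 : ∑ h, Γ'.edgeWeight (S.lift (i, g)) (S.lift (j, h)) • groupElt R h =
      ∑ e : E' with Γ'.src e = S.lift (i, g) ∧ Γ.tgt (π.onE e) = j,
        Γ.wt (π.onE e) • groupElt R (ν (π.onE e) * g) := by
    simp only [edgeWeight, Finset.sum_smul, Finset.sum_filter, ite_smul, zero_smul]
    rw [Finset.sum_comm]
    refine Finset.sum_congr rfl fun e _ => ?_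
    by_cases hs : Γ'.src e = S.lift (i, g)
    · have hi : Γ.src (π.onE e) = i := by rw [π.src_onE, hs, S.onV_lift]
      have ht := hS e g (by rw [hs, hi])
      simp only [hs, ht, true_and, EmbeddingLike.apply_eq_iff_eq, Prod.mk.injEq, ← π.wt_eq]
      by_cases hj : Γ.tgt (π.onE e) = j <;> simp [hj]
    · simp [hs]
  rw [h1]
  refine Finset.sum_nbij π.onE ?_ ?_ ?_ fun e _ => rfl
  · intro e he
    have he' := (Finset.mem_filter.1 he).2
    refine Finset.mem_filter.2 ⟨Finset.mem_univ _, ?_, he'.2⟩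
    rw [π.src_onE, he'.1, S.onV_lift]
  · refine hb.injOn.mono fun e he => ?_
    exact ((Finset.mem_filter.1 he).2).1
  · intro f hf
    have hf' := (Finset.mem_filter.1 hf).2
    obtain ⟨e, he, rfl⟩ := hb.surjOn (show Γ.src f = π.onV (S.lift (i, g)) by
      rw [hf'.1, S.onV_lift])
    exact ⟨e, Finset.mem_coe.2 (Finset.mem_filter.2 ⟨Finset.mem_univ _, he, hf'.2⟩), rfl⟩

variable [Fintype V] [DecidableEq V]

theorem voltageLaplacianMap_single (Γ : WeightedDigraph V E R) (ν : E → G) (i j : V)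
    (c : ReducedGroupAlgebra R G) :
    Γ.voltageLaplacianMap ν (Pi.single i c) j = Γ.voltageLaplacian ν i j * c := by
  simp [voltageLaplacianMap, Pi.single_apply]

/-- The transpose reconciles conventions: `LinearMap.toMatrix` puts images of basis vectors in
columns, `reducedLaplacian` in rows. -/
theorem Cover.Labelling.IsDerived.toMatrix_voltageLaplacianMap [DecidableEq G]
    {S : π.Labelling G} {ν : E → G} (hS : S.IsDerived ν) :
    LinearMap.toMatrix (voltageBasis R G V) (voltageBasis R G V) (Γ.voltageLaplacianMap ν) =
      (S.reducedLaplacian 1)ᵀ := by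
  classical
  have hmap (y : V × {g : G // g ≠ 1}) :
      Γ.voltageLaplacianMap ν (voltageBasis R G V y) =
        ∑ x, S.reducedLaplacian 1 y x • voltageBasis R G V x := by
    obtain ⟨i, g⟩ := y
    -- Substituting `1 = -∑_{h ≠ 1} h` turns each coefficient `a h` into `a h - a 1`.
    have hsum (a : G → R) : ∑ h : {h : G // h ≠ 1}, (a h - a 1) • groupElt R (h : G) =
        ∑ h, a h • groupElt R h := by
      have h0 := sum_groupElt R G
      rw [Fintype.sum_eq_add_sum_subtype_ne _ (1 : G)] at h0
      rw [Fintype.sum_eq_add_sum_subtype_ne _ (1 : G), eq_neg_of_add_eq_zero_left h0]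
      simp only [sub_smul, Finset.sum_sub_distrib, ← Finset.smul_sum, smul_neg]
      abel
    ext1 j
    rw [voltageBasis_apply, voltageLaplacianMap_single, Finset.sum_apply, Fintype.sum_prod_type,
      Finset.sum_eq_single j]
    · simp only [reducedLaplacian_apply, voltageBasis_apply, Pi.smul_apply, Pi.single_eq_same]
      rw [hsum fun h => Γ'.laplacian (S.lift (i, g)) (S.lift (j, h))]
      simp only [laplacian_apply, sub_smul, Finset.sum_sub_distrib, hS.sum_edgeWeight_smul,
        voltageLaplacian, Matrix.sub_apply, of_apply, sub_mul, Finset.sum_mul, smul_mul_assoc,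
        groupElt_mul, EmbeddingLike.apply_eq_iff_eq, π.outWeight_eq, S.onV_lift, Prod.mk.injEq]
      congr 1
      by_cases h : i = j
      · subst h
        simp [Algebra.smul_def, apply_ite (algebraMap R (ReducedGroupAlgebra R G))]
      · simp [h]
    · intro l _ hl
      refine Finset.sum_eq_zero fun h _ => ?_
      simp [voltageBasis_apply, Pi.single_eq_of_ne (Ne.symm hl)]
    · simp
  ext x y
  rw [LinearMap.toMatrix_apply, hmap, map_sum, Finsupp.finsetSum_apply]
  simp [Finsupp.single_apply]

end WeightedDigraph

theorem theorem1p2 {V E V' E' R I : Type*} [Fintype V] [Fintype E] [Fintype V'] [Fintype E']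
    [Fintype I] [CommRing R] [DecidableEq V] [DecidableEq I]
    (Γ : WeightedDigraph V E R) (Γ' : WeightedDigraph V' E' R) (k : ℕ)
    (π : WeightedDigraph.Cover Γ' Γ k) (S : π.Labelling I) (o : I)
    (v : V) (v' : V') (hv : π.onV v' = v) :
    -- the identity with denominators cleared, in the ring of weights
    (k : R) * Γ'.arbSum v' = Γ.arbSum v * (S.reducedLaplacian o).det ∧
    -- the identity of ratios, in every field in which the denominators do not vanish
    (∀ (K : Type*) [Field K] (f : R →+* K), (k : K) ≠ 0 → f (Γ.arbSum v) ≠ 0 →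
      f (Γ'.arbSum v') / f (Γ.arbSum v) = 1 / (k : K) * f (S.reducedLaplacian o).det) ∧
    -- for a derived (regular) cover the matrix is that of the voltage Laplacian over `R`
    (∀ (G : Type*) [Group G] [Fintype G] [DecidableEq G] (ν : E → G) (SG : π.Labelling G),
      SG.IsDerived ν →
      (∃ b : Module.Basis (V × {g : G // g ≠ 1}) R (V → WeightedDigraph.ReducedGroupAlgebra R G),
        (∀ x g, b (x, g) = Pi.single x (WeightedDigraph.groupElt R (g : G))) ∧
        LinearMap.toMatrix b b (Γ.voltageLaplacianMap ν) = (SG.reducedLaplacian 1).transpose) ∧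
      (S.reducedLaplacian o).det = LinearMap.det (Γ.voltageLaplacianMap ν)) := by

  classical
  obtain ⟨⟨u, t⟩, rfl⟩ := S.lift.surjective v'
  rw [S.onV_lift] at hv
  subst hv
  have key : (k : R) * Γ'.arbSum (S.lift (u, t)) = Γ.arbSum u * (S.reducedLaplacian o).det := by
    -- The root's own label `t` is the distinguished one here; independence of the labelling then
    -- replaces `t` by `o`.
    rw [S.natCast_mul_arbSum_lift t u, S.det_reducedLaplacian_eq t S o]
  refine ⟨key, ?_, ?_⟩
  · intro K _ f hk hf
    have h := congrArg f key
    rw [map_mul, map_mul, map_natCast] at h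
    field_simp
    linear_combination h
  · intro G _ _ _ ν SG hS
    have hmat := hS.toMatrix_voltageLaplacianMap
    refine ⟨⟨WeightedDigraph.voltageBasis R G V,
      fun x g => WeightedDigraph.voltageBasis_apply R G (x, g), hmat⟩, ?_⟩
    rw [S.det_reducedLaplacian_eq o SG 1,
      ← LinearMap.det_toMatrix (WeightedDigraph.voltageBasis R G V), hmat, Matrix.det_transpose]
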